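/- **Definitions.** Total variation distance of distributions on $\mathbb Z$ is $d_{TV}(P,Q)=\frac12\sum_{z\in\mathbb Z}|P(z)-Q(z)|$. For a finite set $\mathcal A\subset\mathbb Z_{\ge 0}$, an *$\mathcal A$-sum with $N$ summands* is the distribution of $X_1+\dots+X_N$, where the $X_i$ are independent (not necessarily identically distributed) integer random variables with $\bigcup_i\operatorname{supp}(X_i)=\mathcal A$. A *Poisson binomial distribution (PBD) of order $N$* is the distribution of a sum of $N$ independent $\{0,1\}$-valued random variables. A *learning algorithm with $m$ samples* is a (possibly randomized, computationally unrestricted) map which, from $m$ i.i.d. draws from an unknown distribution $S$ on $\mathbb Z$ and its own independent internal randomness, outputs a hypothesis distribution $\tilde S$ on $\mathbb Z$. It *learns* a class $\mathcal C$ to accuracy $\varepsilon$ if for every $S\in\mathcal C$, $\Pr[d_{TV}(\tilde S,S)\le\varepsilon]\ge 9/10$. **Theorem.** There are absolute constants $\varepsilon_0>0$ and $c>0$ such that for every $0<\varepsilon\le\varepsilon_0$ and every integer $a_{\max}\ge 2$ the following holds. 1. For all sufficiently large $N$ (depending on $a_{\max}$ and $\varepsilon$), every learning algorithm (which may depend on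 $N$, $\varepsilon$, $a_{\max}$) that learns to accuracy $\varepsilon$ the class of all $\{a_1,a_2,a_3\}$-sums with $N$ summands, where $0\le a_1<a_2<a_3\le a_{\max}$ are unknown integers, uses at least $c\log a_{\max}$ samples. 2. The same holds even when $a_1=0$ and $a_3$ are known: let $p$ be the largest prime that is at most $a_{\max}$. For all sufficiently large $N$ (depending on $a_{\max}$ and $\varepsilon$), every learning algorithm (which may depend on $N$, $\varepsilon$, $a_{\max}$, $p$) that learns to accuracy $\varepsilon$ the class of all $\{0,a_2,p\}$-sums with $N$ summands, with unknown $0<a_2<p$, that are distributions of $a_2S_2+pS_3$ for independent PBDs $S_2,S_3$ whose orders add up to $N$, uses at least $c\log a_{\max}$ samples. -/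

import Mathlib

open MeasureTheory Filter

noncomputable section

/-- `S` is the law of `X 0 + ⋯ + X (N - 1)`, the `X i` being independent with the given laws. -/
def IsLawOfSum {N : ℕ} (X : Fin N → PMF ℤ) (S : PMF ℤ) : Prop :=
  S.toMeasure = (Measure.pi fun i => (X i).toMeasure).map fun x : Fin N → ℤ => ∑ i, x i

/-- `S` is an `A`-sum with `N` summands: the law of a sum of `N` independent (not necessarily
identically distributed) integer random variables whose supports have union exactly `A`. -/
def IsSupportSum (A : Set ℤ) (N : ℕ) (S : PMF ℤ) : Prop :=
  ∃ X : Fin N → PMF ℤ, (⋃ i, (X i).support) = A ∧ IsLawOfSum X S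

/-- Poisson binomial distribution of order `N`: the law of a sum of `N` independent
`{0, 1}`-valued random variables. -/
def IsPBD (N : ℕ) (S : PMF ℤ) : Prop :=
  ∃ X : Fin N → PMF ℤ, (∀ i, (X i).support ⊆ {0, 1}) ∧ IsLawOfSum X S

/-- `S` is the law of `a * S₂ + b * S₃` for independent Poisson binomial `S₂`, `S₃`, with `N`
summands in total. -/
def IsWeightedPBDSum (a b : ℤ) (N : ℕ) (S : PMF ℤ) : Prop :=
  ∃ (N₂ N₃ : ℕ) (S₂ S₃ : PMF ℤ), N₂ + N₃ = N ∧ IsPBD N₂ S₂ ∧ IsPBD N₃ S₃ ∧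
    S.toMeasure =
      (S₂.toMeasure.prod S₃.toMeasure).map fun x : ℤ × ℤ => a * x.1 + b * x.2

/-- Total variation distance of two distributions on the integers. -/
def tvDist (P Q : PMF ℤ) : ℝ :=
  (1 / 2) * ∑' z : ℤ, |(P z).toReal - (Q z).toReal|

/-- A randomized learning algorithm (with no restriction on running time) that draws `m` samples:
it maps the sample and an independent random seed to a hypothesis distribution on `ℤ`. -/
structure Learner (m : ℕ) where
  /-- the space of outcomes of the internal randomness -/
  Seed : Type
  [seedSpace : MeasurableSpace Seed]
  /-- the law of the internal randomness -/
  law : Measure Seed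
  [isProb : IsProbabilityMeasure law]
  /-- the hypothesis that is output -/
  output : (Fin m → ℤ) → Seed → PMF ℤ
  measurable_output : ∀ (x : Fin m → ℤ) (z : ℤ), Measurable fun ω => output x ω z

attribute [instance] Learner.seedSpace Learner.isProb

/-- The probability, over `m` i.i.d. draws from `S` and the internal randomness, that the
hypothesis of the learner is within total variation distance `ε` of `S`. -/
def Learner.successProb {m : ℕ} (L : Learner m) (ε : ℝ) (S : PMF ℤ) : ℝ :=
  ((Measure.pi fun _ : Fin m => S.toMeasure).prod L.law).real
    {x : (Fin m → ℤ) × L.Seed | tvDist (L.output x.1 x.2) S ≤ ε}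

/-- The learner learns every distribution of the class `C` to accuracy `ε` with probability at
least `9/10`. -/
def Learner.Learns {m : ℕ} (L : Learner m) (C : Set (PMF ℤ)) (ε : ℝ) : Prop :=
  ∀ S ∈ C, 9 / 10 ≤ L.successProb ε S

/-- All `{a₁, a₂, a₃}`-sums with `N` summands and `0 ≤ a₁ < a₂ < a₃ ≤ amax`. -/
def threeSupportSums (amax N : ℕ) : Set (PMF ℤ) :=
  {S | ∃ a₁ a₂ a₃ : ℤ, 0 ≤ a₁ ∧ a₁ < a₂ ∧ a₂ < a₃ ∧ a₃ ≤ amax ∧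
    IsSupportSum {a₁, a₂, a₃} N S}

/-- All `{0, a₂, p}`-sums with `N` summands and `0 < a₂ < p` which moreover are of the form
`a₂ * S₂ + p * S₃` with independent Poisson binomial `S₂`, `S₃`. Only `a₂`, `S₂`, `S₃` vary. -/
def knownMaxSums (p N : ℕ) : Set (PMF ℤ) :=
  {S | ∃ a₂ : ℤ, 0 < a₂ ∧ a₂ < p ∧
    IsSupportSum {0, a₂, (p : ℤ)} N S ∧ IsWeightedPBDSum a₂ p N S}

end

open scoped ENNReal

/-! The hard instances are `a * S + p * T` with `S`, `T` symmetric binomial of orders `2 * p ^ 2`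
and `n₃ ≥ (4 * p ^ 2) ^ 2`, for `0 < a < p / 2`. A sample is nearly uninformative about `a`, yet the
laws are far apart.

Domination: `S` spreads almost evenly over residues mod `p`, and `T` is so flat that shifts by up to
`2 * p ^ 2` hardly change it. Hence one measure of mass at most 6 majorizes every law pointwise
(`weightedSum_fairBit_le`, `tsum_fairEnvelope_le`).

Separation: a character mod `p` ignores `p * T`. If its frequency inverts `a`, the expectation under
the law of `a` has modulus bounded below, and under any other `b` at most the square of that
(`tvDist_weightedSum_fairBit_ge`).

Counting: success events for separated laws are disjoint, and each `m`-fold product law lies below a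
measure of mass `6 ^ m`. So `0.9 * (p - 1) / 2 ≤ 6 ^ m` (`Learner.card_le_of_dominated`), and
Bertrand's postulate turns `log p` into `log amax`. -/

/-! ### Total decrease of a function on the integers, residue classes and translates -/

/-- Telescoping; truncated subtraction discards the increases, so only downward steps are paid for.
-/
theorem ENNReal.le_add_sum_decrease (f : ℤ → ℝ≥0∞) (k : ℤ) (j : ℕ) :
    f k ≤ f (k + j) + ∑ i ∈ Finset.range j, (f (k + i) - f (k + i + 1)) := by
  induction j with
  | zero => simp
  | succ j ih =>
    rw [Finset.sum_range_succ]
    calc f k ≤ f (k + j) + ∑ i ∈ Finset.range j, (f (k + i) - f (k + i + 1)) := ih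
      _ ≤ (f (k + j + 1) + (f (k + j) - f (k + j + 1))) +
          ∑ i ∈ Finset.range j, (f (k + i) - f (k + i + 1)) := by
        gcongr
        exact le_add_tsub
      _ = _ := by
        push_cast
        rw [← add_assoc k]
        ring

theorem ENNReal.tsum_int_eq_sum_residues (g : ℤ → ℝ≥0∞) (p : ℕ) [NeZero p] (r : ℤ) :
    ∑' z, g z = ∑ j ∈ Finset.range p, ∑' q : ℤ, g (r + p * q + j) := by
  rw [← (Equiv.addLeft r).tsum_eq g, ← (Int.divModEquiv p).symm.tsum_eq, ENNReal.tsum_prod',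
    ENNReal.tsum_comm, tsum_fintype, Finset.sum_range]
  refine Finset.sum_congr rfl fun j _ => tsum_congr fun q => ?_
  simp [Int.divModEquiv, add_assoc, mul_comm]

/-- Compare each `f (r + p * q)` with the other values in its block of length `p`. The blocks tile
the integers, so for each of the `p` offsets the losses add up to at most one total decrease. -/
theorem ENNReal.mul_tsum_residue_le (f : ℤ → ℝ≥0∞) (p : ℕ) [NeZero p] (r : ℤ) :
    p * ∑' q : ℤ, f (r + p * q) ≤ ∑' z, f z + p * ∑' z, (f z - f (z + 1)) := by
  have h : ∀ j ∈ Finset.range p, ∑' q : ℤ, f (r + p * q) ≤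
      ∑' q : ℤ, f (r + p * q + j) + ∑' z, (f z - f (z + 1)) := by
    intro j hj
    rw [ENNReal.tsum_int_eq_sum_residues (fun z => f z - f (z + 1)) p r,
      ← Summable.tsum_finsetSum (fun _ _ => ENNReal.summable), ← ENNReal.tsum_add]
    refine ENNReal.tsum_le_tsum fun q => (ENNReal.le_add_sum_decrease f _ j).trans ?_
    gcongr
    exact (Finset.mem_range.1 hj).le
  have := Finset.sum_le_sum h
  rwa [Finset.sum_add_distrib, ← ENNReal.tsum_int_eq_sum_residues, Finset.sum_const,
    Finset.sum_const, Finset.card_range, nsmul_eq_mul, nsmul_eq_mul] at this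

/-- A majorant of the translates of `f` by `0, …, n`. -/
noncomputable def shiftEnvelope (f : ℤ → ℝ≥0∞) (n : ℕ) (t : ℤ) : ℝ≥0∞ :=
  f t + ∑ i ∈ Finset.range n, (f (t - (i + 1)) - f (t - (i + 1) + 1))

theorem le_shiftEnvelope (f : ℤ → ℝ≥0∞) {n j : ℕ} (hj : j ≤ n) (t : ℤ) :
    f (t - j) ≤ shiftEnvelope f n t := by
  have h := ENNReal.le_add_sum_decrease f (t - j) j
  rw [sub_add_cancel, ← Finset.sum_range_reflect] at h
  refine h.trans ?_
  refine add_le_add le_rfl ?_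
  calc ∑ i ∈ Finset.range j, (f (t - j + (j - 1 - i : ℕ)) - f (t - j + (j - 1 - i : ℕ) + 1))
      = ∑ i ∈ Finset.range j, (f (t - (i + 1)) - f (t - (i + 1) + 1)) := by
        refine Finset.sum_congr rfl fun i hi => ?_
        have hi := Finset.mem_range.1 hi
        have : t - (j : ℤ) + ((j - 1 - i : ℕ) : ℤ) = t - (i + 1) := by omega
        rw [this]
    _ ≤ _ := Finset.sum_le_sum_of_subset (Finset.range_subset_range.2 hj)

theorem tsum_shiftEnvelope (f : ℤ → ℝ≥0∞) (n : ℕ) :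
    ∑' t, shiftEnvelope f n t = ∑' t, f t + n * ∑' t, (f t - f (t + 1)) := by
  unfold shiftEnvelope
  rw [ENNReal.tsum_add, Summable.tsum_finsetSum (fun _ _ => ENNReal.summable)]
  congr 1
  have h : ∀ i ∈ Finset.range n, ∑' t : ℤ, (f (t - (i + 1)) - f (t - (i + 1) + 1)) =
      ∑' t, (f t - f (t + 1)) := fun i _ =>
    (Equiv.subRight ((i : ℤ) + 1)).tsum_eq fun t => f t - f (t + 1)
  rw [Finset.sum_congr rfl h, Finset.sum_const, Finset.card_range, nsmul_eq_mul]

/-! ### The symmetric binomial distribution -/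

/-- This is the binomial variance, read off from the Bernstein polynomials at `1 / 2`. -/
theorem sum_choose_mul_sub_sq (n : ℕ) :
    ∑ k ∈ Finset.range (n + 1), (n.choose k : ℝ) * (2 * (k : ℝ) - n) ^ 2 = (n : ℝ) * 2 ^ n := by
  have h := congrArg (Polynomial.eval (1 / 2 : ℝ)) (bernsteinPolynomial.variance ℝ n)
  simp only [Polynomial.eval_finsetSum, Polynomial.eval_mul, Polynomial.eval_pow,
    Polynomial.eval_sub, Polynomial.eval_X, Polynomial.eval_natCast,
    bernsteinPolynomial, Polynomial.eval_one, nsmul_eq_mul] at h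
  have h2 : ∀ k ∈ Finset.range (n + 1), (n.choose k : ℝ) * (2 * (k : ℝ) - n) ^ 2 =
      4 * 2 ^ n * (((n : ℝ) * (1 / 2) - k) ^ 2 *
        ((n.choose k : ℝ) * (1 / 2) ^ k * (1 - 1 / 2) ^ (n - k))) := by
    intro k hk
    have hk : k ≤ n := Nat.lt_succ_iff.1 (Finset.mem_range.1 hk)
    have : (2 : ℝ) ^ n = 2 ^ k * 2 ^ (n - k) := by rw [← pow_add]; congr 1; omega
    rw [this]
    have h3 : (1 - 1 / 2 : ℝ) = 1 / 2 := by norm_num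
    rw [h3, one_div_pow, one_div_pow]
    field_simp
    ring
  rw [Finset.sum_congr rfl h2, ← Finset.mul_sum, h]
  ring

theorem sum_choose_mul_abs_sub_le (n : ℕ) :
    ∑ k ∈ Finset.range (n + 1), (n.choose k : ℝ) * |2 * (k : ℝ) - n| ≤ √n * 2 ^ n := by
  rcases Nat.eq_zero_or_pos n with rfl | hn
  · simp
  have hs : 0 < √(n : ℝ) := Real.sqrt_pos.2 (by exact_mod_cast hn)
  have hss : √(n : ℝ) * √n = n := Real.mul_self_sqrt (by positivity)
  have hc : ∑ k ∈ Finset.range (n + 1), (n.choose k : ℝ) = 2 ^ n := by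
    exact_mod_cast Nat.sum_range_choose n
  have h : (2 * √(n : ℝ)) * ∑ k ∈ Finset.range (n + 1), (n.choose k : ℝ) * |2 * (k : ℝ) - n| ≤
      ∑ k ∈ Finset.range (n + 1), (n.choose k : ℝ) * (2 * (k : ℝ) - n) ^ 2 +
        n * ∑ k ∈ Finset.range (n + 1), (n.choose k : ℝ) := by
    rw [Finset.mul_sum, Finset.mul_sum, ← Finset.sum_add_distrib]
    refine Finset.sum_le_sum fun k _ => ?_
    -- AM-GM replaces Cauchy–Schwarz in passing from the second to the first absolute moment.
    have : 2 * √(n : ℝ) * |2 * (k : ℝ) - n| ≤ (2 * (k : ℝ) - n) ^ 2 + n := by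
      rw [← sq_abs (2 * (k : ℝ) - n)]
      nlinarith [sq_nonneg (√(n : ℝ) - |2 * (k : ℝ) - n|)]
    calc _ = (n.choose k : ℝ) * (2 * √(n : ℝ) * |2 * (k : ℝ) - n|) := by ring
      _ ≤ (n.choose k : ℝ) * ((2 * (k : ℝ) - n) ^ 2 + n) := by gcongr
      _ = _ := by ring
  rw [sum_choose_mul_sub_sq, hc] at h
  refine le_of_mul_le_mul_left (h.trans_eq ?_) (by positivity : 0 < 2 * √(n : ℝ))
  linear_combination (-2 * 2 ^ n) * hss

/-- The difference of neighbouring coefficients is `(n + 1).choose (k + 1) * (2 * (k + 1) - (n + 1))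
/ (n + 1)`, so the sum is a first absolute moment of order `n + 1`, less its term at 0. -/
theorem sum_abs_choose_sub_choose_le (n : ℕ) :
    ∑ k ∈ Finset.range (n + 1), |(n.choose k : ℝ) - n.choose (k + 1)| ≤
      2 / √(n + 1) * 2 ^ n := by
  have h0 := sum_choose_mul_abs_sub_le (n + 1)
  rw [Finset.sum_range_succ'] at h0
  have hn : (0 : ℝ) < n + 1 := by positivity
  have hss : √((n : ℝ) + 1) * √(n + 1) = n + 1 := Real.mul_self_sqrt hn.le
  have hs : 0 < √((n : ℝ) + 1) := Real.sqrt_pos.2 hn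
  have h1 : ∀ k ∈ Finset.range (n + 1), |(n.choose k : ℝ) - n.choose (k + 1)| =
      ((n + 1).choose (k + 1) : ℝ) * |2 * ((k + 1 : ℕ) : ℝ) - (n + 1 : ℕ)| / (n + 1) := by
    intro k hk
    have hk : k ≤ n := Nat.lt_succ_iff.1 (Finset.mem_range.1 hk)
    have e1 : ((n : ℝ) + 1) * n.choose k = (n + 1).choose (k + 1) * (k + 1) := by
      exact_mod_cast Nat.add_one_mul_choose_eq n k
    have e2 : ((n + 1).choose (k + 1) : ℝ) = n.choose k + n.choose (k + 1) := by
      exact_mod_cast Nat.choose_succ_succ n k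
    rw [eq_div_iff hn.ne', ← abs_of_nonneg (Nat.cast_nonneg (α := ℝ) ((n + 1).choose (k + 1))),
      ← abs_mul]
    nth_rewrite 1 [← abs_of_pos hn]
    rw [← abs_mul]
    congr 1
    push_cast
    linear_combination 2 * e1 + (n + 1) * e2
  rw [Finset.sum_congr rfl h1, ← Finset.sum_div, div_le_iff₀ hn]
  have : (0 : ℝ) ≤ ((n + 1).choose 0 : ℝ) * |2 * ((0 : ℕ) : ℝ) - (n + 1 : ℕ)| := by positivity
  push_cast at h0 this ⊢
  calc _ ≤ √((n : ℝ) + 1) * 2 ^ (n + 1) := by linarith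
    _ = 2 / √((n : ℝ) + 1) * 2 ^ n * (n + 1) := by
      field_simp
      rw [Real.sq_sqrt hn.le]
      ring

/-! ### Laws of sums of independent integer random variables -/

section SumLaw

variable {ι κ : Type*} [Fintype ι] [Fintype κ]

/-- The law of the sum of independent random variables with the given laws. -/
noncomputable def sumLaw (X : ι → PMF ℤ) : Measure ℤ :=
  (Measure.pi fun i => (X i).toMeasure).map fun x : ι → ℤ => ∑ i, x i

instance (X : ι → PMF ℤ) : IsProbabilityMeasure (sumLaw X) :=
  Measure.isProbabilityMeasure_map (by fun_prop)

theorem sumLaw_comp_equiv (X : κ → PMF ℤ) (e : ι ≃ κ) : sumLaw (X ∘ e) = sumLaw X := by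
  have h := (measurePreserving_piCongrLeft (fun i => (X i).toMeasure) e).map_eq
  rw [sumLaw, sumLaw, ← h, Measure.map_map (by fun_prop) (MeasurableEquiv.measurable _)]
  congr 1
  funext x
  simp only [Function.comp_apply, MeasurableEquiv.coe_piCongrLeft]
  rw [← e.sum_comp]
  exact Finset.sum_congr rfl fun i _ => (Equiv.piCongrLeft_apply_apply (fun _ : κ => ℤ) e x i).symm

theorem sumLaw_sumElim (X : ι → PMF ℤ) (Y : κ → PMF ℤ) :
    sumLaw (Sum.elim X Y) = ((sumLaw X).prod (sumLaw Y)).map fun x : ℤ × ℤ => x.1 + x.2 := by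
  have h := (measurePreserving_sumPiEquivProdPi_symm
    (fun i : ι ⊕ κ => (Sum.elim X Y i).toMeasure)).map_eq
  have h2 : (sumLaw X).prod (sumLaw Y) =
      ((Measure.pi fun i => (X i).toMeasure).prod (Measure.pi fun i => (Y i).toMeasure)).map
        (Prod.map (fun x : ι → ℤ => ∑ i, x i) (fun x : κ → ℤ => ∑ i, x i)) :=
    Measure.map_prod_map _ _ (by fun_prop) (by fun_prop)
  rw [h2, sumLaw, ← h, Measure.map_map (by fun_prop) (MeasurableEquiv.measurable _),
    Measure.map_map (by fun_prop) (by fun_prop)]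
  congr 1
  funext x
  simp [MeasurableEquiv.sumPiEquivProdPi, Equiv.sumPiEquivProdPi]

theorem sumLaw_map_mul (X : ι → PMF ℤ) (c : ℤ) :
    sumLaw (fun i => (X i).map (c * ·)) = (sumLaw X).map (c * ·) := by
  have h : (fun i => ((X i).map (c * ·)).toMeasure) =
      fun i => (X i).toMeasure.map (c * ·) :=
    funext fun i => (PMF.toMeasure_map _ _ (by fun_prop)).symm
  have h2 := Measure.pi_map_pi (μ := fun i => (X i).toMeasure) (f := fun _ z => c * z)
    fun _ => by fun_prop
  rw [sumLaw, h, ← h2, sumLaw,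
    Measure.map_map (by fun_prop) (by fun_prop), Measure.map_map (by fun_prop) (by fun_prop)]
  congr 1
  funext x
  simp [Finset.mul_sum]

theorem sumLaw_of_unique [Unique ι] (X : ι → PMF ℤ) : sumLaw X = (X default).toMeasure := by
  have h := (measurePreserving_piUnique (fun i => (X i).toMeasure)).map_eq
  rw [sumLaw, ← h]
  congr 1
  funext x
  simp

theorem sumLaw_of_isEmpty [IsEmpty ι] (X : ι → PMF ℤ) : sumLaw X = Measure.dirac 0 := by
  rw [sumLaw, Measure.pi_of_empty, Measure.map_dirac' (by fun_prop)]
  simp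

theorem integral_sumLaw {ι : Type*} [Fintype ι] (X : ι → PMF ℤ) (χ : ℤ → ℂ)
    (h0 : χ 0 = 1) (hadd : ∀ x y, χ (x + y) = χ x * χ y) :
    ∫ z, χ z ∂(sumLaw X) = ∏ i, ∫ z, χ z ∂(X i).toMeasure := by
  have h : ∀ (s : Finset ι) (x : ι → ℤ), χ (∑ i ∈ s, x i) = ∏ i ∈ s, χ (x i) := by
    intro s x
    classical
    induction s using Finset.induction_on with
    | empty => simpa using h0
    | insert a s ha ih => rw [Finset.sum_insert ha, Finset.prod_insert ha, hadd, ih]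
  rw [sumLaw, integral_map (by fun_prop) (by fun_prop)]
  simp_rw [h]
  exact integral_fintype_prod_eq_prod (fun _ => χ)

/-- The law of `a * S + b * T` for independent `S`, `T` which are sums of independent random
variables with the given laws. -/
noncomputable def weightedSum (a b : ℤ) (X : ι → PMF ℤ) (Y : κ → PMF ℤ) : Measure ℤ :=
  ((sumLaw X).prod (sumLaw Y)).map fun x : ℤ × ℤ => a * x.1 + b * x.2

instance (a b : ℤ) (X : ι → PMF ℤ) (Y : κ → PMF ℤ) :
    IsProbabilityMeasure (weightedSum a b X Y) :=
  Measure.isProbabilityMeasure_map (by fun_prop)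

theorem weightedSum_eq_sumLaw (a b : ℤ) (X : ι → PMF ℤ) (Y : κ → PMF ℤ) :
    weightedSum a b X Y =
      sumLaw (Sum.elim (fun i => (X i).map (a * ·)) (fun i => (Y i).map (b * ·))) := by
  rw [sumLaw_sumElim, sumLaw_map_mul, sumLaw_map_mul,
    Measure.map_prod_map _ _ (by fun_prop) (by fun_prop),
    Measure.map_map (by fun_prop) (by fun_prop)]
  rfl

end SumLaw

theorem weightedSum_mem_knownMaxSums {p N n₂ n₃ : ℕ} (hN : n₂ + n₃ = N) {a : ℤ} (ha : 0 < a)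
    (hap : a < p) (X : Fin n₂ → PMF ℤ) (Y : Fin n₃ → PMF ℤ)
    (hX : ∀ i, (X i).support ⊆ {0, 1}) (hY : ∀ i, (Y i).support ⊆ {0, 1})
    (hsupp : (⋃ i, (a * ·) '' (X i).support) ∪ (⋃ i, ((p : ℤ) * ·) '' (Y i).support) =
      {0, a, (p : ℤ)}) :
    (weightedSum a p X Y).toPMF ∈ knownMaxSums p N := by
  subst hN
  refine ⟨a, ha, hap, ⟨Sum.elim (fun i => (X i).map (a * ·)) (fun i => (Y i).map ((p : ℤ) * ·)) ∘
    finSumFinEquiv.symm, ?_, ?_⟩, n₂, n₃, (sumLaw X).toPMF, (sumLaw Y).toPMF, rfl,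
    ⟨X, hX, ?_⟩, ⟨Y, hY, ?_⟩, ?_⟩
  · rw [← hsupp]
    refine (finSumFinEquiv.symm.surjective.iUnion_comp fun i =>
      (Sum.elim (fun i => (X i).map (a * ·)) (fun i => (Y i).map ((p : ℤ) * ·)) i).support).trans ?_
    rw [Set.iUnion_sum]
    simp [PMF.support_map]
  · rw [IsLawOfSum, Measure.toPMF_toMeasure, weightedSum_eq_sumLaw]
    exact (sumLaw_comp_equiv _ _).symm
  · rw [IsLawOfSum, Measure.toPMF_toMeasure, sumLaw]
  · rw [IsLawOfSum, Measure.toPMF_toMeasure, sumLaw]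
  · rw [Measure.toPMF_toMeasure, Measure.toPMF_toMeasure, Measure.toPMF_toMeasure, weightedSum]

/-! ### Fair bits -/

/-- The uniform distribution on `{0, 1}`. -/
noncomputable def fairBit : PMF ℤ := PMF.uniformOfFinset {0, 1} (Finset.insert_nonempty _ _)

theorem support_fairBit : fairBit.support = {0, 1} := by
  simp [fairBit]

theorem fairBit_toMeasure : fairBit.toMeasure =
    (2⁻¹ : ℝ≥0∞) • (Measure.dirac 0 + Measure.dirac 1) := by
  refine Measure.ext_of_singleton fun z => ?_
  rw [PMF.toMeasure_apply_singleton _ _ (measurableSet_singleton _), fairBit,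
    PMF.uniformOfFinset_apply]
  by_cases h0 : z = 0
  · subst h0; simp
  by_cases h1 : z = 1
  · subst h1; simp
  simp [h0, h1, Ne.symm h0, Ne.symm h1]

theorem integral_fairBit (f : ℤ → ℂ) : ∫ z, f z ∂fairBit.toMeasure = (f 0 + f 1) / 2 := by
  rw [fairBit_toMeasure, integral_smul_measure, integral_add_measure, integral_dirac,
    integral_dirac]
  · simp; ring
  · exact integrable_dirac (by simp)
  · exact integrable_dirac (by simp)

/-- The symmetric binomial distribution of order `n`. -/
noncomputable def fairSum (n : ℕ) : Measure ℤ := sumLaw fun _ : Fin n => fairBit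

instance (n : ℕ) : IsProbabilityMeasure (fairSum n) := by unfold fairSum; infer_instance

theorem fairSum_succ (n : ℕ) (k : ℤ) :
    fairSum (n + 1) {k} = 2⁻¹ * (fairSum n {k} + fairSum n {k - 1}) := by
  have h : fairSum (n + 1) =
      ((fairSum n).prod fairBit.toMeasure).map fun x : ℤ × ℤ => x.1 + x.2 := by
    rw [fairSum, fairSum, ← sumLaw_of_unique (fun _ : Fin 1 => fairBit), ← sumLaw_sumElim,
      ← sumLaw_comp_equiv _ finSumFinEquiv]
    congr 1
    funext i
    cases i <;> rfl
  rw [h, Measure.map_apply (by fun_prop) (measurableSet_singleton _),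
    Measure.prod_apply_symm (measurableSet_preimage (by fun_prop) (measurableSet_singleton _)),
    fairBit_toMeasure]
  simp only [lintegral_smul_measure, lintegral_add_measure, lintegral_dirac, smul_eq_mul]
  congr 3
  · ext; simp
  · ext; simp [eq_sub_iff_add_eq]

theorem fairSum_zero (k : ℤ) : fairSum 0 {k} = if k = 0 then 1 else 0 := by
  rw [fairSum, sumLaw_of_isEmpty]
  by_cases h : k = 0
  · simp [h]
  · simp [h, Ne.symm h]

theorem fairSum_singleton_of_neg (n : ℕ) : ∀ {k : ℤ}, k < 0 → fairSum n {k} = 0 := by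
  induction n with
  | zero => intro k hk; rw [fairSum_zero, if_neg hk.ne]
  | succ n ih => intro k hk; rw [fairSum_succ, ih hk, ih (by omega)]; simp

theorem fairSum_singleton (n k : ℕ) : fairSum n {(k : ℤ)} = n.choose k / 2 ^ n := by
  induction n generalizing k with
  | zero => rw [fairSum_zero]; cases k <;> simp; omega
  | succ n ih =>
    rw [fairSum_succ, ih]
    have h2 : (2 ^ (n + 1) : ℝ≥0∞)⁻¹ = 2⁻¹ * (2 ^ n)⁻¹ := by
      rw [pow_succ', ENNReal.mul_inv (by simp) (by simp)]
    cases k with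
    | zero =>
      rw [fairSum_singleton_of_neg n (by simp), div_eq_mul_inv, div_eq_mul_inv, h2]
      simp
    | succ k =>
      rw [show ((k + 1 : ℕ) : ℤ) - 1 = k by simp, ih, Nat.choose_succ_succ, div_eq_mul_inv,
        div_eq_mul_inv, div_eq_mul_inv, h2]
      push_cast
      ring

theorem tsum_fairSum (n : ℕ) : ∑' k, fairSum n {k} = 1 := by
  have := (fairSum n).tsum_indicator_apply_singleton Set.univ MeasurableSet.univ
  simpa using this

theorem tsum_fairSum_decrease_le (n : ℕ) :
    ∑' k : ℤ, (fairSum n {k} - fairSum n {k + 1}) ≤ ENNReal.ofReal (2 / √(n + 1)) := by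
  have hinj : Function.Injective ((↑) : ℕ → ℤ) := Nat.cast_injective
  -- Negative `k` contribute nothing: the mass at `k` is 0, so the truncated difference vanishes,
  -- including the rise from `-1` to `0`.
  rw [← hinj.tsum_eq (f := fun k : ℤ => fairSum n {k} - fairSum n {k + 1}),
    tsum_eq_sum (s := Finset.range (n + 1))]
  · calc _ ≤ ∑ k ∈ Finset.range (n + 1),
          ENNReal.ofReal (|(n.choose k : ℝ) - n.choose (k + 1)| / 2 ^ n) := by
          refine Finset.sum_le_sum fun k _ => ?_
          have h : ∀ c : ℕ, (c : ℝ≥0∞) / 2 ^ n = ENNReal.ofReal (c / 2 ^ n) := by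
            intro c
            rw [ENNReal.ofReal_div_of_pos (by positivity), ENNReal.ofReal_natCast,
              ENNReal.ofReal_pow (by norm_num)]
            simp
          rw [show ((k : ℤ) + 1) = ((k + 1 : ℕ) : ℤ) by simp, fairSum_singleton,
            fairSum_singleton, h, h, ← ENNReal.ofReal_sub _ (by positivity), ← sub_div]
          gcongr
          exact le_abs_self _
      _ = ENNReal.ofReal (∑ k ∈ Finset.range (n + 1),
            |(n.choose k : ℝ) - n.choose (k + 1)| / 2 ^ n) :=
          (ENNReal.ofReal_sum_of_nonneg fun _ _ => by positivity).symm
      _ ≤ _ := by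
          rw [← Finset.sum_div]
          refine ENNReal.ofReal_le_ofReal ?_
          rw [div_le_iff₀ (by positivity)]
          exact sum_abs_choose_sub_choose_le n
  · intro k hk
    have hk : n < k := by simpa using hk
    rw [fairSum_singleton, Nat.choose_eq_zero_of_lt hk]
    simp
  · intro k hk
    rcases lt_or_ge k 0 with h | h
    · simp [fairSum_singleton_of_neg n h] at hk
    · exact ⟨k.toNat, by simp [h]⟩

/-! ### Total variation distance -/

theorem PMF.summable_toReal (P : PMF ℤ) : Summable fun z => (P z).toReal :=
  ENNReal.summable_toReal P.tsum_coe_ne_top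

theorem summable_abs_sub_toReal (P Q : PMF ℤ) :
    Summable fun z => |(P z).toReal - (Q z).toReal| :=
  (P.summable_toReal.sub Q.summable_toReal).abs

theorem tvDist_le_add (R P Q : PMF ℤ) : tvDist P Q ≤ tvDist R P + tvDist R Q := by
  unfold tvDist
  rw [← mul_add, ← (summable_abs_sub_toReal R P).tsum_add (summable_abs_sub_toReal R Q)]
  refine mul_le_mul_of_nonneg_left ?_ (by norm_num)
  refine (summable_abs_sub_toReal P Q).tsum_le_tsum (fun z => ?_)
    ((summable_abs_sub_toReal R P).add (summable_abs_sub_toReal R Q))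
  rw [abs_sub_comm (R z).toReal (P z).toReal]
  exact abs_sub_le _ _ _

theorem norm_integral_sub_integral_le_tvDist (P Q : PMF ℤ) (χ : ℤ → ℂ) (hχ : ∀ z, ‖χ z‖ ≤ 1) :
    ‖∫ z, χ z ∂P.toMeasure - ∫ z, χ z ∂Q.toMeasure‖ ≤ 2 * tvDist P Q := by
  have hint : ∀ R : PMF ℤ, Integrable χ R.toMeasure := fun R =>
    Integrable.of_bound (by fun_prop) 1 (Eventually.of_forall hχ)
  have hsum : ∀ R : PMF ℤ, Summable fun z => (R z).toReal • χ z := fun R =>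
    Summable.of_norm_bounded R.summable_toReal fun z => by
      rw [norm_smul, Real.norm_of_nonneg ENNReal.toReal_nonneg]
      exact mul_le_of_le_one_right ENNReal.toReal_nonneg (hχ z)
  rw [PMF.integral_eq_tsum P _ (hint P), PMF.integral_eq_tsum Q _ (hint Q),
    ← (hsum P).tsum_sub (hsum Q), tvDist, ← mul_assoc]
  norm_num
  refine tsum_of_norm_bounded (summable_abs_sub_toReal P Q).hasSum fun z => ?_
  rw [← sub_mul, ← Complex.ofReal_sub, norm_mul, Complex.norm_real]
  exact mul_le_of_le_one_right (abs_nonneg _) (hχ z)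

/-! ### A counting lower bound for learning -/

namespace Learner

variable {m : ℕ}

/-- The samples and seeds for which the learner succeeds. -/
def successSet (L : Learner m) (ε : ℝ) (S : PMF ℤ) : Set ((Fin m → ℤ) × L.Seed) :=
  {x | tvDist (L.output x.1 x.2) S ≤ ε}

theorem measurableSet_successSet (L : Learner m) (ε : ℝ) (S : PMF ℤ) :
    MeasurableSet (L.successSet ε S) := by
  have h : Measurable fun x : (Fin m → ℤ) × L.Seed => tvDist (L.output x.1 x.2) S := by
    refine measurable_from_prod_countable_right fun x => ?_
    refine Measurable.const_mul (Measurable.tsum fun z => ?_) _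
    exact ((L.measurable_output x z).ennreal_toReal.sub_const _).abs
  exact measurableSet_le h measurable_const

theorem _root_.MeasureTheory.Measure.le_of_singleton_le {α : Type*} [MeasurableSpace α]
    [Countable α] [MeasurableSingletonClass α] {μ ν : Measure α} (h : ∀ x, μ {x} ≤ ν {x}) :
    μ ≤ ν := by
  refine Measure.le_iff.2 fun s hs => ?_
  rw [← μ.tsum_indicator_apply_singleton s hs, ← ν.tsum_indicator_apply_singleton s hs]
  exact ENNReal.tsum_le_tsum fun x => Set.indicator_le_indicator (h x)

/-- No hypothesis can be `ε`-close to two of the laws, so the success events are disjoint. Measured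
by the common majorant `ν ^ m` times the seed law, they fit into total mass `(ν univ) ^ m`. -/
theorem card_le_of_dominated (L : Learner m) {ι : Type*} [Fintype ι] (S : ι → PMF ℤ)
    (ν : Measure ℤ) [IsFiniteMeasure ν] (hν : ∀ i z, S i z ≤ ν {z}) {ε : ℝ}
    (hfar : ∀ i j, i ≠ j → 2 * ε < tvDist (S i) (S j))
    (hL : ∀ i, 9 / 10 ≤ L.successProb ε (S i)) :
    (Fintype.card ι : ℝ) * (9 / 10) ≤ (ν.real Set.univ) ^ m := by
  have hle : ∀ i, (Measure.pi fun _ : Fin m => (S i).toMeasure) ≤ Measure.pi fun _ => ν := by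
    intro i
    refine Measure.le_of_singleton_le fun x => ?_
    rw [Measure.pi_singleton, Measure.pi_singleton]
    refine Finset.prod_le_prod' fun j _ => ?_
    rw [PMF.toMeasure_apply_singleton _ _ (measurableSet_singleton _)]
    exact hν i _
  have hmeas := fun i => L.measurableSet_successSet ε (S i)
  have hdisj : Pairwise fun i j => Disjoint (L.successSet ε (S i)) (L.successSet ε (S j)) := by
    intro i j hij
    refine Set.disjoint_left.2 fun x hi hj => ?_
    have h1 := tvDist_le_add (L.output x.1 x.2) (S i) (S j)
    have h2 := hfar i j hij
    have hi : tvDist (L.output x.1 x.2) (S i) ≤ ε := hi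
    have hj : tvDist (L.output x.1 x.2) (S j) ≤ ε := hj
    linarith
  have h1 : ∑ i, ((Measure.pi fun _ : Fin m => (S i).toMeasure).prod L.law)
      (L.successSet ε (S i)) ≤ ν Set.univ ^ m := by
    calc _ ≤ ∑ i, ((Measure.pi fun _ : Fin m => ν).prod L.law) (L.successSet ε (S i)) := by
          refine Finset.sum_le_sum fun i _ => ?_
          exact Measure.prod_mono (hle i) le_rfl _
      _ ≤ ((Measure.pi fun _ : Fin m => ν).prod L.law) Set.univ :=
          sum_measure_le_measure_univ (fun i _ => (hmeas i).nullMeasurableSet)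
            fun i _ j _ hij => (hdisj hij).aedisjoint
      _ = _ := by
          rw [← Set.univ_prod_univ, Measure.prod_prod, measure_univ (μ := L.law),
            mul_one, Measure.pi_univ]
          simp
  have h2 := ENNReal.toReal_mono (ENNReal.pow_ne_top (measure_ne_top ν _)) h1
  rw [ENNReal.toReal_sum (fun _ _ => measure_ne_top _ _), ENNReal.toReal_pow] at h2
  refine le_trans ?_ h2
  rw [← nsmul_eq_mul, ← Finset.card_univ, ← Finset.sum_const]
  exact Finset.sum_le_sum fun i _ => hL i

end Learner

theorem exists_finiteMeasure_of_tsum_le (U : ℤ → ℝ≥0∞) {K : ℝ≥0∞} (hK : K ≠ ∞)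
    (hU : ∑' z, U z ≤ K) :
    ∃ ν : Measure ℤ, IsFiniteMeasure ν ∧ ν Set.univ ≤ K ∧ ∀ z, ν {z} = U z := by
  have huniv : (Measure.count.withDensity U) Set.univ = ∑' z, U z := by
    rw [withDensity_apply _ MeasurableSet.univ, Measure.restrict_univ, lintegral_count]
  refine ⟨Measure.count.withDensity U, ⟨?_⟩, huniv.trans_le hU, fun z => ?_⟩
  · rw [huniv]
    exact hU.trans_lt hK.lt_top
  · rw [withDensity_apply _ (measurableSet_singleton _), lintegral_singleton]
    simp

/-! ### Weighted sums of fair bits are uniformly dominated -/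

theorem weightedSum_singleton {ι κ : Type*} [Fintype ι] [Fintype κ] (a b : ℤ) (X : ι → PMF ℤ)
    (Y : κ → PMF ℤ) (z : ℤ) :
    weightedSum a b X Y {z} = ∑' s : ℤ, sumLaw Y {t | a * s + b * t = z} * sumLaw X {s} := by
  rw [weightedSum, Measure.map_apply (by fun_prop) (measurableSet_singleton _),
    Measure.prod_apply (measurableSet_preimage (by fun_prop) (measurableSet_singleton _)),
    lintegral_countable']
  rfl

/-- At order at least `p ^ 2` the total decrease is at most `2 / p`; the constant is `3 = 1 + 2`. -/
theorem fairSum_residue_le {p n : ℕ} (hp : 0 < p) (hn : p ^ 2 ≤ n) (s₀ : ℤ) :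
    ∑' q : ℤ, fairSum n {s₀ + p * q} ≤ 3 / p := by
  have : NeZero p := ⟨hp.ne'⟩
  have h := ENNReal.mul_tsum_residue_le (fun k => fairSum n {k}) p s₀
  rw [tsum_fairSum] at h
  rw [ENNReal.le_div_iff_mul_le (by simp [hp.ne']) (by simp), mul_comm]
  refine h.trans ?_
  have h2 : (p : ℝ≥0∞) * ENNReal.ofReal (2 / √(n + 1)) ≤ 2 := by
    rw [← ENNReal.ofReal_natCast, ← ENNReal.ofReal_mul (by positivity)]
    refine (ENNReal.ofReal_le_ofReal ?_).trans_eq (ENNReal.ofReal_ofNat 2)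
    have h3 : (p : ℝ) ≤ √(n + 1) := by
      refine Real.le_sqrt_of_sq_le ?_
      have : ((p ^ 2 : ℕ) : ℝ) ≤ n := by exact_mod_cast hn
      push_cast at this
      linarith
    rw [mul_div_assoc', div_le_iff₀ (by positivity)]
    linarith
  calc _ ≤ 1 + (p : ℝ≥0∞) * ENNReal.ofReal (2 / √(n + 1)) := by
        gcongr
        exact tsum_fairSum_decrease_le n
    _ ≤ 1 + 2 := by gcongr
    _ = 3 := by norm_num

/-- A common majorant of the laws of `a * S + p * T`, where `S`, `T` are symmetric binomial of
orders `n₂`, `n₃`, and `0 < a < p`. -/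
noncomputable def fairEnvelope (p n₂ n₃ : ℕ) (z : ℤ) : ℝ≥0∞ :=
  3 / p * shiftEnvelope (fun k => fairSum n₃ {k}) n₂ (z / p)

/-- Writing `z = a * s + p * t` confines `s` to one residue class mod `p`, of mass at most `3 / p`,
and makes `t` equal to `z / p` shifted down by `a * s / p ∈ [0, n₂]`. The envelope absorbs this
shift, so `a` disappears. -/
theorem weightedSum_fairBit_le {p n₂ n₃ : ℕ} (hp : p.Prime) (hn : p ^ 2 ≤ n₂) {a : ℤ}
    (ha : 0 < a) (hap : a < p) (z : ℤ) :
    weightedSum a p (fun _ : Fin n₂ => fairBit) (fun _ : Fin n₃ => fairBit) {z} ≤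
      fairEnvelope p n₂ n₃ z := by
  have hp0 : (0 : ℤ) < p := by exact_mod_cast hp.pos
  have hcop : IsCoprime (p : ℤ) a := by
    rw [Int.isCoprime_iff_nat_coprime]
    refine (Nat.Prime.coprime_iff_not_dvd (by simpa using hp)).2 fun h => ?_
    have := Int.le_of_dvd ha (Int.natAbs_dvd_natAbs.1 h)
    omega
  rw [weightedSum_singleton]
  change ∑' s : ℤ, fairSum n₃ {t | a * s + p * t = z} * fairSum n₂ {s} ≤ _
  by_cases hex : ∃ s₀ t₀ : ℤ, a * s₀ + p * t₀ = z
  swap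
  · push Not at hex
    rw [ENNReal.tsum_eq_zero.2 fun s => ?_]
    · exact zero_le
    · have he : {t | a * s + p * t = z} = ∅ := Set.eq_empty_of_forall_notMem (hex s)
      rw [he, measure_empty, zero_mul]
  obtain ⟨s₀, t₀, h₀⟩ := hex
  have hinj : Function.Injective fun q : ℤ => s₀ + p * q := by
    intro q q' h
    have h : s₀ + p * q = s₀ + p * q' := h
    exact mul_left_cancel₀ hp0.ne' (add_left_cancel h)
  rw [← hinj.tsum_eq]
  · calc _ ≤ ∑' q : ℤ, shiftEnvelope (fun k => fairSum n₃ {k}) n₂ (z / p) *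
          fairSum n₂ {s₀ + p * q} := by
          refine ENNReal.tsum_le_tsum fun q => ?_
          generalize s₀ + p * q = s
          rcases lt_or_ge s 0 with hs | hs
          · rw [fairSum_singleton_of_neg n₂ hs]; simp
          rcases lt_or_ge (n₂ : ℤ) s with hs' | hs'
          · lift s to ℕ using hs
            rw [fairSum_singleton, Nat.choose_eq_zero_of_lt (by exact_mod_cast hs')]
            simp
          gcongr
          have hj0 : 0 ≤ a * s / p := by positivity
          have hj : a * s / p ≤ n₂ := by
            refine (Int.ediv_le_ediv hp0 (mul_le_mul hap.le hs' hs hp0.le)).trans ?_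
            rw [Int.mul_ediv_cancel_left _ hp0.ne']
          refine le_trans (measure_mono fun t ht => ?_)
            (le_shiftEnvelope (fun k => fairSum n₃ {k}) (j := (a * s / p).toNat) (by omega) (z / p))
          have ht : a * s + p * t = z := ht
          rw [Set.mem_singleton_iff, Int.toNat_of_nonneg hj0, ← ht,
            Int.add_mul_ediv_left _ _ hp0.ne']
          ring
      _ ≤ _ := by
          rw [ENNReal.tsum_mul_left, mul_comm, fairEnvelope]
          gcongr
          exact fairSum_residue_le hp.pos hn s₀
  · intro s hs
    obtain ⟨t, ht⟩ : ∃ t, a * s + p * t = z := by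
      by_contra! h
      refine hs ?_
      change fairSum n₃ {t | a * s + p * t = z} * fairSum n₂ {s} = 0
      have he : {t | a * s + p * t = z} = ∅ := Set.eq_empty_of_forall_notMem h
      rw [he, measure_empty, zero_mul]
    have hdvd : (p : ℤ) ∣ a * (s - s₀) := ⟨t₀ - t, by linear_combination ht - h₀⟩
    obtain ⟨q, hq⟩ := hcop.dvd_of_dvd_mul_left hdvd
    exact ⟨q, by linear_combination -hq⟩

/-- Each value of `z / p` is taken `p` times, cancelling the `p` in `3 / p`. The shifts cost at most
`n₂ * 2 / √(n₃ + 1) ≤ 1`, whence `3 * (1 + 1)`. -/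
theorem tsum_fairEnvelope_le {p n₂ n₃ : ℕ} (hp : 0 < p) (hn : (2 * n₂) ^ 2 ≤ n₃) :
    ∑' z, fairEnvelope p n₂ n₃ z ≤ 6 := by
  have : NeZero p := ⟨hp.ne'⟩
  have hp0 : (p : ℤ) ≠ 0 := by exact_mod_cast hp.ne'
  rw [ENNReal.tsum_int_eq_sum_residues _ p 0]
  have h : ∀ j ∈ Finset.range p, ∑' q : ℤ, fairEnvelope p n₂ n₃ (0 + p * q + j) =
      3 / p * ∑' q : ℤ, shiftEnvelope (fun k => fairSum n₃ {k}) n₂ q := by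
    intro j hj
    rw [← ENNReal.tsum_mul_left]
    refine tsum_congr fun q => ?_
    have : (0 + (p : ℤ) * q + j) / p = q := by
      rw [zero_add, add_comm, Int.add_mul_ediv_left _ _ hp0, Int.ediv_eq_zero_of_lt (by simp)
        (by exact_mod_cast Finset.mem_range.1 hj), zero_add]
    rw [fairEnvelope, this]
  rw [Finset.sum_congr rfl h, Finset.sum_const, Finset.card_range, nsmul_eq_mul, ← mul_assoc,
    ENNReal.mul_div_cancel (by simp [hp.ne']) (by simp), tsum_shiftEnvelope, tsum_fairSum]
  have h2 : (n₂ : ℝ≥0∞) * ∑' k : ℤ, (fairSum n₃ {k} - fairSum n₃ {k + 1}) ≤ 1 := by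
    calc _ ≤ (n₂ : ℝ≥0∞) * ENNReal.ofReal (2 / √(n₃ + 1)) := by
          gcongr
          exact tsum_fairSum_decrease_le n₃
      _ = ENNReal.ofReal (n₂ * (2 / √(n₃ + 1))) := by
          rw [ENNReal.ofReal_mul (by positivity), ENNReal.ofReal_natCast]
      _ ≤ ENNReal.ofReal 1 := by
          refine ENNReal.ofReal_le_ofReal ?_
          have h3 : (2 * n₂ : ℝ) ≤ √(n₃ + 1) := by
            refine Real.le_sqrt_of_sq_le ?_
            have : (((2 * n₂) ^ 2 : ℕ) : ℝ) ≤ n₃ := by exact_mod_cast hn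
            push_cast at this
            linarith
          rw [mul_div_assoc', div_le_iff₀ (by positivity)]
          linarith
      _ = 1 := by simp
  calc _ ≤ (3 : ℝ≥0∞) * (1 + 1) := by gcongr
    _ = 6 := by norm_num

/-! ### Characters modulo `p` -/

/-- The additive character `z ↦ exp (2 π i c z / p)`. -/
noncomputable def zchar (p : ℕ) (c z : ℤ) : ℂ :=
  Complex.exp ((2 * Real.pi * (c * z : ℤ) / p : ℝ) * Complex.I)

theorem zchar_zero (p : ℕ) (c : ℤ) : zchar p c 0 = 1 := by simp [zchar]

theorem zchar_add (p : ℕ) (c x y : ℤ) : zchar p c (x + y) = zchar p c x * zchar p c y := by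
  rw [zchar, zchar, zchar, ← Complex.exp_add]
  congr 1
  push_cast
  ring

theorem norm_zchar (p : ℕ) (c z : ℤ) : ‖zchar p c z‖ = 1 := Complex.norm_exp_ofReal_mul_I _

theorem zchar_re (p : ℕ) (c z : ℤ) :
    (zchar p c z).re = Real.cos (2 * Real.pi * (c * z : ℤ) / p) :=
  Complex.exp_ofReal_mul_I_re _

theorem zchar_mul_self {p : ℕ} (hp : 0 < p) (c : ℤ) : zchar p c p = 1 := by
  have hp : (p : ℂ) ≠ 0 := by exact_mod_cast hp.ne'
  rw [zchar, Complex.exp_eq_one_iff]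
  refine ⟨c, ?_⟩
  push_cast
  field_simp

theorem integral_map_mul_zchar (P : PMF ℤ) (p : ℕ) (c a : ℤ) :
    ∫ z, zchar p c z ∂(P.map (a * ·)).toMeasure = ∫ z, zchar p c (a * z) ∂P.toMeasure := by
  rw [← PMF.toMeasure_map _ _ (by fun_prop), integral_map (by fun_prop) (by fun_prop)]

theorem integral_weightedSum_zchar {p : ℕ} (hp : 0 < p) {ι κ : Type*} [Fintype ι] [Fintype κ]
    (c a : ℤ) (X : ι → PMF ℤ) :
    ∫ z, zchar p c z ∂(weightedSum a p X (fun _ : κ => fairBit)) =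
      ∏ i, ∫ z, zchar p c (a * z) ∂(X i).toMeasure := by
  rw [weightedSum_eq_sumLaw, integral_sumLaw _ _ (zchar_zero p c) (zchar_add p c),
    Fintype.prod_sum_type]
  simp only [Sum.elim_inl, Sum.elim_inr, integral_map_mul_zchar, integral_fairBit]
  simp [zchar_zero, zchar_mul_self hp]

theorem norm_one_add_zchar_div_two_sq (p : ℕ) (c a : ℤ) :
    ‖(1 + zchar p c a) / 2‖ ^ 2 = (1 + Real.cos (2 * Real.pi * (c * a : ℤ) / p)) / 2 := by
  have h1 : Complex.normSq (zchar p c a) = 1 := by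
    rw [Complex.normSq_eq_norm_sq, norm_zchar, one_pow]
  rw [← Complex.normSq_eq_norm_sq, Complex.normSq_div, Complex.normSq_add, h1]
  simp [zchar_re]
  ring

/-- The even order `2 * l` avoids square roots, since only the squared norm of one factor occurs. -/
theorem norm_integral_fair_zchar {p : ℕ} (hp : 0 < p) (l : ℕ) {κ : Type*} [Fintype κ] (c a : ℤ) :
    ‖∫ z, zchar p c z ∂(weightedSum a p (fun _ : Fin (2 * l) => fairBit)
      (fun _ : κ => fairBit))‖ = ((1 + Real.cos (2 * Real.pi * (c * a : ℤ) / p)) / 2) ^ l := by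
  rw [integral_weightedSum_zchar hp]
  simp only [integral_fairBit, mul_zero, mul_one, zchar_zero]
  rw [Finset.prod_const, Finset.card_univ, Fintype.card_fin, norm_pow, pow_mul,
    norm_one_add_zchar_div_two_sq]

theorem cos_two_pi_mul_emod_div {p : ℕ} (hp : 0 < p) (k : ℤ) :
    Real.cos (2 * Real.pi * k / p) = Real.cos (2 * Real.pi * (k % p : ℤ) / p) := by
  have hp' : (p : ℝ) ≠ 0 := by exact_mod_cast hp.ne'
  rw [← Real.cos_add_int_mul_two_pi (2 * Real.pi * (k % p : ℤ) / p) (k / p)]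
  congr 1
  have h : (k : ℝ) = (k % p : ℤ) + p * (k / p : ℤ) := by exact_mod_cast (Int.emod_add_mul_ediv k p).symm
  rw [h]
  field_simp

theorem cos_two_pi_mul_div_le {p : ℕ} {k : ℤ} (h2 : 2 ≤ k) (hk : k ≤ p - 2) :
    Real.cos (2 * Real.pi * k / p) ≤ Real.cos (2 * Real.pi * 2 / p) := by
  have hp : (0 : ℝ) < p := by
    have : (0 : ℤ) < p := by omega
    exact_mod_cast this
  have key : ∀ k : ℤ, 2 ≤ k → 2 * k ≤ p →
      Real.cos (2 * Real.pi * k / p) ≤ Real.cos (2 * Real.pi * 2 / p) := by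
    intro k h2 hk
    have h2 : (2 : ℝ) ≤ k := by exact_mod_cast h2
    have hk : 2 * (k : ℝ) ≤ p := by exact_mod_cast hk
    have := Real.pi_pos
    refine Real.cos_le_cos_of_nonneg_of_le_pi (by positivity) ?_ ?_
    · rw [div_le_iff₀ hp]; nlinarith
    · gcongr
  rcases le_total (2 * k) p with h | h
  · exact key k h2 h
  · refine le_trans (le_of_eq ?_) (key (p - k) (by omega) (by omega))
    rw [← Real.cos_neg, ← Real.cos_add_two_pi]
    congr 1
    push_cast
    field_simp
    ring

/-- The last bound reads `c ^ 2 ≤ ((1 + c) / 2) ^ 2` for `c = cos (2 * π / p) ∈ [0, 1]`; it makes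
the competing character value at most the square of the main one. -/
theorem cos_power_bounds {p : ℕ} (hp : 5 ≤ p) :
    Real.exp (-20) ≤ ((1 + Real.cos (2 * Real.pi / p)) / 2) ^ (p ^ 2) ∧
      ((1 + Real.cos (2 * Real.pi / p)) / 2) ^ (p ^ 2) ≤ 1 / 2 ∧
      (1 + Real.cos (2 * Real.pi * 2 / p)) / 2 ≤ ((1 + Real.cos (2 * Real.pi / p)) / 2) ^ 2 := by
  have hp' : (5 : ℝ) ≤ p := by exact_mod_cast hp
  have hpi := Real.pi_pos
  have hpi2 : Real.pi ^ 2 ≤ 10 := by nlinarith [Real.pi_lt_d2, Real.pi_gt_three]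
  have hu : 10 / (p : ℝ) ^ 2 ≤ 1 / 2 := by
    rw [div_le_iff₀ (by positivity)]; nlinarith
  have hθ : 2 * Real.pi / p ≤ Real.pi / 2 := by
    rw [div_le_div_iff₀ (by positivity) (by positivity)]; nlinarith
  have hθ0 : 0 ≤ 2 * Real.pi / p := by positivity
  have hc0 : 0 ≤ Real.cos (2 * Real.pi / p) := Real.cos_nonneg_of_mem_Icc ⟨by linarith, hθ⟩
  have hc1 := Real.cos_le_one (2 * Real.pi / p)
  set g := (1 + Real.cos (2 * Real.pi / p)) / 2 with hg
  refine ⟨?_, ?_, ?_⟩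
  · have h1 : 1 - 10 / (p : ℝ) ^ 2 ≤ g := by
      have := Real.one_sub_sq_div_two_le_cos (x := 2 * Real.pi / p)
      have h3 : (2 * Real.pi / p) ^ 2 = 4 * (Real.pi ^ 2 / p ^ 2) := by ring
      have h4 : Real.pi ^ 2 / (p : ℝ) ^ 2 ≤ 10 / p ^ 2 := by gcongr
      rw [h3] at this
      linarith
    set u := 10 / (p : ℝ) ^ 2 with hu'
    have hu0 : 0 ≤ u := by positivity
    -- Valid because `u ≤ 1 / 2`; as `u = 10 / p ^ 2`, the `p ^ 2`-th power yields `exp (-20)`.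
    have h2 : Real.exp (-(2 * u)) ≤ 1 - u := by
      rw [Real.exp_neg, inv_le_comm₀ (Real.exp_pos _) (by linarith)]
      refine le_trans ?_ (Real.add_one_le_exp (2 * u))
      rw [inv_le_iff_one_le_mul₀ (by linarith)]
      nlinarith
    calc Real.exp (-20) = Real.exp (-(2 * u)) ^ (p ^ 2) := by
          rw [← Real.exp_nat_mul]
          congr 1
          rw [hu']
          push_cast
          field_simp
          norm_num
      _ ≤ g ^ (p ^ 2) := by gcongr; exact h2.trans h1
  · have h1 : g ≤ Real.exp (-(4 / p ^ 2)) := by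
      have h := Real.cos_le_one_sub_mul_cos_sq (x := 2 * Real.pi / p)
        (by rw [abs_of_nonneg hθ0]; linarith)
      have h3 : 2 / Real.pi ^ 2 * (2 * Real.pi / p) ^ 2 = 2 * (4 / (p : ℝ) ^ 2) := by
        field_simp
        norm_num
      rw [h3] at h
      have := Real.one_sub_le_exp_neg (4 / (p : ℝ) ^ 2)
      linarith
    calc g ^ (p ^ 2) ≤ Real.exp (-(4 / p ^ 2)) ^ (p ^ 2) := by gcongr
      _ = Real.exp (-4) := by
          rw [← Real.exp_nat_mul]
          congr 1
          push_cast
          field_simp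
      _ ≤ 1 / 2 := by
          rw [Real.exp_neg, inv_le_comm₀ (Real.exp_pos _) (by norm_num)]
          exact le_trans (by norm_num) (Real.add_one_le_exp 4)
  · have h : 2 * Real.pi * 2 / (p : ℝ) = 2 * (2 * Real.pi / p) := by ring
    rw [h, Real.cos_two_mul, hg]
    nlinarith

theorem norm_integral_zchar_sub_le_tvDist (μ ν : Measure ℤ) [IsProbabilityMeasure μ]
    [IsProbabilityMeasure ν] (p : ℕ) (c : ℤ) :
    ‖∫ z, zchar p c z ∂μ - ∫ z, zchar p c z ∂ν‖ ≤ 2 * tvDist μ.toPMF ν.toPMF := by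
  have h := norm_integral_sub_integral_le_tvDist μ.toPMF ν.toPMF (zchar p c)
    fun z => (norm_zchar p c z).le
  rwa [Measure.toPMF_toMeasure, Measure.toPMF_toMeasure] at h

/-- Distinct dilations of a binomial distribution of order `2 * p ^ 2` stay apart, even after
adding multiples of `p`. -/
theorem tvDist_weightedSum_fairBit_ge {p : ℕ} (hp : p.Prime) (hp5 : 5 ≤ p) (n₃ : ℕ) {a b : ℤ}
    (ha : 0 < a) (hap : 2 * a < p) (hb : 0 < b) (hbp : 2 * b < p) (hab : a ≠ b) :
    Real.exp (-20) / 4 ≤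
      tvDist (weightedSum a p (fun _ : Fin (2 * p ^ 2) => fairBit)
          (fun _ : Fin n₃ => fairBit)).toPMF
        (weightedSum b p (fun _ : Fin (2 * p ^ 2) => fairBit)
          (fun _ : Fin n₃ => fairBit)).toPMF := by
  have not_dvd : ∀ x : ℤ, x ≠ 0 → |x| < p → ¬ (p : ℤ) ∣ x := fun x hx hxp h =>
    hx (Int.eq_zero_of_abs_lt_dvd h hxp)
  have hpZ : Prime (p : ℤ) := Nat.prime_iff_prime_int.1 hp
  -- The frequency `c` is the inverse of `a` mod `p`.
  obtain ⟨k, c, hkc⟩ : IsCoprime (p : ℤ) a :=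
    (hpZ.irreducible.coprime_iff_not_dvd).2 (not_dvd a ha.ne' (by rw [abs_of_pos ha]; omega))
  have hca : c * a % p = 1 := by
    have h : c * a = 1 + p * (-k) := by linear_combination hkc
    rw [h, Int.add_mul_emod_self_left]
    exact Int.emod_eq_of_lt (by norm_num) (by omega)
  have hr0 : 0 ≤ c * b % p := Int.emod_nonneg _ (by omega)
  have hrp : c * b % p < p := Int.emod_lt_of_pos _ (by omega)
  have hdiv := Int.emod_add_mul_ediv (c * b) p
  have hr_mul : ∀ r : ℤ, c * b % p = r → (p : ℤ) ∣ b - a * r := by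
    intro r hr
    rw [hr] at hdiv
    exact ⟨b * k + a * (c * b / p), by linear_combination -b * hkc + (-a) * hdiv⟩
  -- The residues 0, 1, -1 of `c * b` would force `p` to divide `b`, `b - a` or `b + a`; all are
  -- nonzero and smaller than `p` in absolute value, as `a` and `b` lie below `p / 2`.
  have h0 : c * b % p ≠ 0 := fun h =>
    not_dvd (b - a * 0) (by omega) (by rw [abs_lt]; omega) (hr_mul 0 h)
  have h1 : c * b % p ≠ 1 := fun h =>
    not_dvd (b - a * 1) (by omega) (by rw [abs_lt]; omega) (hr_mul 1 h)
  have h2 : c * b % p ≠ p - 1 := fun h => by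
    have h := dvd_add (hr_mul _ h) (dvd_mul_left (p : ℤ) a)
    rw [show b - a * (p - 1) + a * p = b + a by ring] at h
    exact not_dvd (b + a) (by omega) (by rw [abs_lt]; omega) h
  have hA := norm_integral_fair_zchar hp.pos (p ^ 2) (κ := Fin n₃) c a
  have hB := norm_integral_fair_zchar hp.pos (p ^ 2) (κ := Fin n₃) c b
  rw [cos_two_pi_mul_emod_div hp.pos, hca, Int.cast_one, mul_one] at hA
  rw [cos_two_pi_mul_emod_div hp.pos] at hB
  have hcos := cos_two_pi_mul_div_le (p := p) (k := c * b % p) (by omega) (by omega)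
  obtain ⟨e1, e2, e3⟩ := cos_power_bounds hp5
  set g := (1 + Real.cos (2 * Real.pi / p)) / 2
  have hB' : ((1 + Real.cos (2 * Real.pi * (c * b % p : ℤ) / p)) / 2) ^ (p ^ 2) ≤
      (g ^ (p ^ 2)) ^ 2 := by
    rw [pow_right_comm]
    refine pow_le_pow_left₀ ?_ ?_ (p ^ 2)
    · linarith [Real.neg_one_le_cos (2 * Real.pi * (c * b % p : ℤ) / p)]
    · linarith
  have htv := norm_integral_zchar_sub_le_tvDist
    (weightedSum a p (fun _ : Fin (2 * p ^ 2) => fairBit) (fun _ : Fin n₃ => fairBit))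
    (weightedSum b p (fun _ : Fin (2 * p ^ 2) => fairBit) (fun _ : Fin n₃ => fairBit)) p c
  have hn := norm_sub_norm_le
    (∫ z, zchar p c z ∂(weightedSum a p (fun _ : Fin (2 * p ^ 2) => fairBit)
      (fun _ : Fin n₃ => fairBit)))
    (∫ z, zchar p c z ∂(weightedSum b p (fun _ : Fin (2 * p ^ 2) => fairBit)
      (fun _ : Fin n₃ => fairBit)))
  rw [hA, hB] at hn
  -- With `x = g ^ (p ^ 2) ∈ [exp (-20), 1 / 2]` the gap is at least `x - x ^ 2 ≥ x / 2`.
  nlinarith [Real.exp_pos (-20)]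

/-! ### Sample lower bounds for large and small primes, and the theorem -/

theorem card_le_six_pow_of_learns {p N : ℕ} (hp : p.Prime) (hp5 : 5 ≤ p)
    (hN : 2 * p ^ 2 + (4 * p ^ 2) ^ 2 ≤ N) {ε : ℝ} (hε : ε ≤ Real.exp (-20) / 16) {m : ℕ}
    (L : Learner m) (hL : L.Learns (knownMaxSums p N) ε) :
    (((p - 1) / 2 : ℕ) : ℝ) * (9 / 10) ≤ 6 ^ m := by
  obtain ⟨n₃, rfl⟩ := Nat.exists_eq_add_of_le (le_of_add_le_left hN)
  have hn₃ : (2 * (2 * p ^ 2)) ^ 2 ≤ n₃ := by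
    rw [← mul_assoc]
    exact Nat.le_of_add_le_add_left hN
  have hn₃0 : 0 < n₃ := lt_of_lt_of_le (by have := hp.pos; positivity) hn₃
  obtain ⟨ν, hν, hν6, hνU⟩ := exists_finiteMeasure_of_tsum_le _ (by simp)
    (tsum_fairEnvelope_le hp.pos hn₃)
  have hpos : ∀ i : Fin ((p - 1) / 2), 0 < (i : ℤ) + 1 := fun i => by positivity
  have hlt : ∀ i : Fin ((p - 1) / 2), 2 * ((i : ℤ) + 1) < p := fun i => by have := i.2; omega
  have h := L.card_le_of_dominated (ι := Fin ((p - 1) / 2))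
    (fun i => (weightedSum ((i : ℤ) + 1) p (fun _ : Fin (2 * p ^ 2) => fairBit)
      (fun _ : Fin n₃ => fairBit)).toPMF) ν (ε := ε) (fun i z => ?_) (fun i j hij => ?_)
      fun i => hL _ ?_
  · rw [Fintype.card_fin] at h
    refine h.trans ?_
    gcongr
    exact (ENNReal.toReal_mono (by simp) hν6).trans (by simp)
  · rw [hνU]
    exact weightedSum_fairBit_le hp (by omega) (hpos i) (by linarith [hlt i, hpos i]) z
  · have := tvDist_weightedSum_fairBit_ge hp hp5 n₃ (hpos i) (hlt i) (hpos j) (hlt j)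
      fun h => hij (Fin.ext (by omega))
    linarith [Real.exp_pos (-20)]
  · refine weightedSum_mem_knownMaxSums rfl (hpos i) (by linarith [hlt i, hpos i]) _ _
      (fun _ => support_fairBit.subset) (fun _ => support_fairBit.subset) ?_
    have : Nonempty (Fin (2 * p ^ 2)) := ⟨0, by have := hp.pos; positivity⟩
    have : Nonempty (Fin n₃) := ⟨0, hn₃0⟩
    simp only [support_fairBit, Set.iUnion_const, Set.image_pair, mul_zero, mul_one]
    ext
    simp
    tauto

/-- For these primes `amax` is bounded, so one sample is all that must be forced. Two laws in the
class, `1 + p * T` and `2 + p * T'`, are separated by a character mod `p`, since `cos (2 * π / p) ≤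
0`. -/
theorem ne_zero_of_learns {p N : ℕ} (hp : p.Prime) (hp4 : p ≤ 4) (hN : 3 ≤ N) {ε : ℝ}
    (hε : ε ≤ Real.exp (-20) / 16) {m : ℕ} (L : Learner m)
    (hL : L.Learns (knownMaxSums p N) ε) : m ≠ 0 := by
  rintro rfl
  have hp2 := hp.two_le
  let μ : Fin 2 → Measure ℤ := fun i => weightedSum 1 p (fun _ : Fin (i + 1) => PMF.pure 1)
    (fun _ : Fin (N - (i + 1)) => fairBit)
  have hprob : ∀ i, IsProbabilityMeasure (μ i) := fun i => by
    change IsProbabilityMeasure (weightedSum _ _ _ _)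
    infer_instance
  have hcos : Real.cos (2 * Real.pi / p) ≤ 0 := by
    have h2 : (2 : ℝ) ≤ p := by exact_mod_cast hp2
    have h4 : (p : ℝ) ≤ 4 := by exact_mod_cast hp4
    have := Real.pi_pos
    refine Real.cos_nonpos_of_pi_div_two_le_of_le ?_ ?_
    · rw [div_le_div_iff₀ (by norm_num) (by positivity)]; nlinarith
    · rw [div_le_iff₀ (by positivity)]; nlinarith
  have hint : ∀ i, ∫ z, zchar p 1 z ∂(μ i) = zchar p 1 1 ^ (i.val + 1) := fun i => by
    change ∫ z, zchar p 1 z ∂(weightedSum _ _ _ _) = _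
    rw [integral_weightedSum_zchar hp.pos]
    simp [PMF.toMeasure_pure]
  have hfar : 1 ≤ 2 * tvDist (μ 0).toPMF (μ 1).toPMF := by
    refine le_trans ?_ (norm_integral_zchar_sub_le_tvDist (μ 0) (μ 1) p 1)
    have hre := Complex.abs_re_le_norm (1 - zchar p 1 1)
    rw [Complex.sub_re, zchar_re] at hre
    simp only [mul_one, Int.cast_one, Complex.one_re] at hre
    have hf : zchar p 1 1 ^ (0 + 1) - zchar p 1 1 ^ (1 + 1) =
      zchar p 1 1 * (1 - zchar p 1 1) := by ring
    rw [hint, hint, Fin.val_zero, Fin.val_one, hf, norm_mul, norm_zchar, one_mul]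
    linarith [le_abs_self (1 - Real.cos (2 * Real.pi / p))]
  have hexp : Real.exp (-20) ≤ 1 := Real.exp_le_one_iff.2 (by norm_num)
  have h := L.card_le_of_dominated (fun i => (μ i).toPMF) (μ 0 + μ 1) (ε := ε) (fun i z => ?_)
    (fun i j hij => ?_) fun i => hL _ ?_
  -- With `m = 0` the majorant enters to the power 0, so any finite one serves: `2 * (9 / 10) ≤ 1`
  -- is absurd.
  · norm_num at h
  · rw [Measure.toPMF_apply, Measure.add_apply]
    fin_cases i
    · exact le_self_add
    · exact le_add_self
  · have hsymm : tvDist (μ 1).toPMF (μ 0).toPMF = tvDist (μ 0).toPMF (μ 1).toPMF := by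
      simp only [tvDist, abs_sub_comm]
    fin_cases i <;> fin_cases j
    · exact absurd rfl hij
    · change 2 * ε < tvDist (μ 0).toPMF (μ 1).toPMF
      linarith
    · change 2 * ε < tvDist (μ 1).toPMF (μ 0).toPMF
      linarith
    · exact absurd rfl hij
  · have hi := i.2
    refine weightedSum_mem_knownMaxSums (by omega) (by norm_num) (by exact_mod_cast hp2) _ _
      (fun _ => by simp) (fun _ => support_fairBit.subset) ?_
    have : Nonempty (Fin (i + 1)) := ⟨0, by omega⟩
    have : Nonempty (Fin (N - (i + 1))) := ⟨0, by omega⟩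
    simp only [support_fairBit, PMF.support_pure, Set.iUnion_const, Set.image_pair,
      Set.image_singleton, mul_zero, mul_one]
    ext
    simp
    tauto

/-- Bertrand's postulate. -/
theorem lt_two_mul_of_isGreatest_prime {n p : ℕ}
    (hp : IsGreatest {q : ℕ | q.Prime ∧ q ≤ n} p) : n < 2 * p := by
  obtain ⟨q, hq, hpq, hq2⟩ := Nat.exists_prime_lt_and_le_two_mul p hp.1.1.ne_zero
  by_contra! h
  exact absurd (hp.2 ⟨hq, hq2.trans h⟩) hpq.not_ge

theorem log_le_of_learns_knownMaxSums {amax p N : ℕ} (hamax : 2 ≤ amax)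
    (hp : IsGreatest {q : ℕ | q.Prime ∧ q ≤ amax} p)
    (hN : 2 * p ^ 2 + (4 * p ^ 2) ^ 2 ≤ N) {ε : ℝ} (hε : ε ≤ Real.exp (-20) / 16) {m : ℕ}
    (L : Learner m) (hL : L.Learns (knownMaxSums p N) ε) :
    1 / 10 * Real.log amax ≤ m := by
  have hpp : p.Prime := hp.1.1
  have hp2 := hpp.two_le
  have hlt : (amax : ℝ) + 1 ≤ 2 * p := by exact_mod_cast lt_two_mul_of_isGreatest_prime hp
  have ha0 : (0 : ℝ) < amax := by positivity
  rcases lt_or_ge p 5 with h5 | h5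
  · have hp4 : p ≤ 4 := by omega
    have hN3 : 3 ≤ N := by nlinarith
    have hm : (1 : ℝ) ≤ m := by
      exact_mod_cast Nat.one_le_iff_ne_zero.2 (ne_zero_of_learns hpp hp4 hN3 hε L hL)
    have hlog := Real.log_le_sub_one_of_pos ha0
    have : (p : ℝ) ≤ 4 := by exact_mod_cast hp4
    linarith
  · have h := card_le_six_pow_of_learns hpp h5 hN hε L hL
    have hM2 : (2 : ℝ) ≤ ((p - 1) / 2 : ℕ) := by
      have : 2 ≤ (p - 1) / 2 := by omega
      exact_mod_cast this
    have hMp : (p : ℝ) ≤ 2 * ((p - 1) / 2 : ℕ) + 2 := by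
      have : p ≤ 2 * ((p - 1) / 2) + 2 := by omega
      exact_mod_cast this
    have hm0 : m ≠ 0 := by
      rintro rfl
      norm_num at h
      linarith
    have h6 : (6 : ℝ) ≤ 6 ^ m := le_self_pow₀ (by norm_num) hm0
    -- With `M = (p - 1) / 2`, `amax ≤ 4 * M + 3 ≤ (40 / 9) * 6 ^ m + 3 ≤ 6 * 6 ^ m`. Then `log 6 ≤
    -- 5` gives `log amax ≤ 10 * m`, the source of `1 / 10`.
    have hle : (amax : ℝ) ≤ 6 ^ (2 * m) := by
      rw [two_mul, pow_add]
      nlinarith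
    have hlog := Real.log_le_log ha0 hle
    rw [Real.log_pow] at hlog
    have hlog6 := Real.log_le_sub_one_of_pos (show (0 : ℝ) < 6 by norm_num)
    push_cast at hlog
    nlinarith [(Nat.cast_nonneg m : (0 : ℝ) ≤ m)]

theorem knownMaxSums_subset_threeSupportSums {p amax : ℕ} (h : p ≤ amax) (N : ℕ) :
    knownMaxSums p N ⊆ threeSupportSums amax N := by
  rintro S ⟨a, ha, hap, hS, -⟩
  exact ⟨0, a, p, le_rfl, ha, hap, by exact_mod_cast h, hS⟩

theorem exists_isGreatest_prime_le {n : ℕ} (hn : 2 ≤ n) :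
    ∃ p, IsGreatest {q : ℕ | q.Prime ∧ q ≤ n} p := by
  have hfin : {q : ℕ | q.Prime ∧ q ≤ n}.Finite := (Set.finite_Iic n).subset fun _ hq => hq.2
  obtain ⟨p, hp⟩ := hfin.exists_maximal ⟨2, Nat.prime_two, hn⟩
  exact ⟨p, hp.prop, fun q hq => (le_total q p).elim id (hp.le_of_ge hq)⟩

theorem theorem6 :
    ∃ ε₀ : ℝ, 0 < ε₀ ∧ ∃ c : ℝ, 0 < c ∧
      ∀ ε : ℝ, 0 < ε → ε ≤ ε₀ → ∀ amax : ℕ, 2 ≤ amax →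
        (∀ᶠ N : ℕ in atTop, ∀ (m : ℕ) (L : Learner m),
          L.Learns (threeSupportSums amax N) ε → c * Real.log amax ≤ m) ∧
        (∀ p : ℕ, IsGreatest {q : ℕ | q.Prime ∧ q ≤ amax} p →
          ∀ᶠ N : ℕ in atTop, ∀ (m : ℕ) (L : Learner m),
            L.Learns (knownMaxSums p N) ε → c * Real.log amax ≤ m) := by
  -- This `ε₀` keeps `2 * ε` strictly below the separation `exp (-20) / 4`.
  refine ⟨Real.exp (-20) / 16, by positivity, 1 / 10, by norm_num, ?_⟩
  intro ε _ hε amax hamax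
  have hknown : ∀ p : ℕ, IsGreatest {q : ℕ | q.Prime ∧ q ≤ amax} p →
      ∀ᶠ N : ℕ in atTop, ∀ (m : ℕ) (L : Learner m),
        L.Learns (knownMaxSums p N) ε → 1 / 10 * Real.log amax ≤ m := fun p hp => by
    filter_upwards [eventually_ge_atTop (2 * p ^ 2 + (4 * p ^ 2) ^ 2)] with N hN m L hL
    exact log_le_of_learns_knownMaxSums hamax hp hN hε L hL
  refine ⟨?_, hknown⟩
  obtain ⟨p, hp⟩ := exists_isGreatest_prime_le hamax
  filter_upwards [hknown p hp] with N hN m L hL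
  exact hN m L fun S hS => hL S (knownMaxSums_subset_threeSupportSums hp.1.2 N hS)
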